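/- Let $n,r\in\mathbb{N}$ with $2<r<n$. Let $A$ be a set of $r$-element subsets of $\{1,\ldots,n\}$ and let $B$ be a set of partitions of $\{1,\ldots,n\}$, each with exactly $r$ classes. Let $T_n$ be the semigroup of all maps $\{1,\ldots,n\}\to\{1,\ldots,n\}$ under composition, and let \[ S(A,B)=\langle\,\{\alpha\in T_n : \operatorname{im}\alpha\in A,\ \ker\alpha\in B\}\,\rangle\le T_n \] be the subsemigroup generated by all maps with image in $A$ and kernel in $B$, where $\ker\alpha$ is the partition of $\{1,\ldots,n\}$ into the non-empty fibres of $\alpha$. Let $\Gamma(A,B)$ be the bipartite graph with vertex set $A\cup B$ (disjoint union) in which $a\in A$ and $b\in B$ are adjacent if and only if $a$ is a transversal of $b$, that is, $a$ contains exactly one point of each class of $b$. For a set $X$ of vertices let $v_0(X)$ and $v_+(X)$ be the numbers of vertices in $X$ whose degree in $\Gamma(A,B)$ is zero and positive, respectively, and let $\Delta$ be the maximum degree of a vertex of $\Gamma(A,B)$ (with $\Delta=0$ if there are no vertices). The rank of a finite semigroup $S$ is $\operatorname{rank}(S)=\min\{|X| : X\subseteq S,\ \langle X\rangle=S\}$,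 where $\langle X\rangle$ is the subsemigroup generated by $X$ (the empty semigroup has rank $0$). Then \[ \operatorname{rank}(S(A,B))=\begin{cases} \max(v_+(A),v_+(B))+v_0(A\cup B) & \text{if } \Delta\ge 2,\\ \max(v_+(A),v_+(B))+v_0(A\cup B)+1 & \text{if } \Delta=1,\\ |A|\,|B|\,r! & \text{if } \Delta=0. \end{cases} \] -/

import Mathlib

/-- The rank of a finite semigroup `S`: the least cardinality of a subset generating `S`
as a semigroup. -/
noncomputable def semigroupRank (S : Type*) [Mul S] [Finite S] : ℕ :=
  sInf {k : ℕ | ∃ X : Finset S, X.card = k ∧ Subsemigroup.closure (X : Set S) = ⊤}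

/-- The minimum defining the rank of a finite semigroup is attained. -/
theorem semigroupRank_isLeast (S : Type*) [Mul S] [Finite S] :
    IsLeast {k : ℕ | ∃ X : Finset S, X.card = k ∧ Subsemigroup.closure (X : Set S) = ⊤}
      (semigroupRank S) := by
  refine ⟨Nat.sInf_mem ?_, fun k hk => Nat.sInf_le hk⟩
  have := Fintype.ofFinite S
  exact ⟨_, Finset.univ, rfl, by simp⟩

/-- The semigroup `S(A,B)`: the subsemigroup of the full transformation monoid on `Fin n`
generated by all maps with image in `A` and kernel in `B`. Partitions of `Fin n` are given as
equivalence relations. -/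
def prescribedSemigroup {n : ℕ} (A : Finset (Finset (Fin n))) (B : Finset (Setoid (Fin n))) :
    Subsemigroup (Function.End (Fin n)) :=
  Subsemigroup.closure
    {α : Function.End (Fin n) | (∃ a ∈ A, Set.range α = (a : Set (Fin n))) ∧ Setoid.ker α ∈ B}

instance {n : ℕ} (A : Finset (Finset (Fin n))) (B : Finset (Setoid (Fin n))) :
    Finite (prescribedSemigroup A B) :=
  have : Finite (Function.End (Fin n)) := inferInstanceAs (Finite (Fin n → Fin n))
  Subtype.finite

/-- `a` is a transversal of the partition into the classes of `b`: it meets every class in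
exactly one point. -/
def IsTransversal {n : ℕ} (a : Finset (Fin n)) (b : Setoid (Fin n)) : Prop :=
  ∀ c ∈ b.classes, ∃! x, x ∈ a ∧ x ∈ c

/-- The bipartite graph `Γ(A,B)` on the disjoint union of `A` and `B`, with `a` joined to `b`
if and only if `a` is a transversal of `b`. -/
def transversalGraph {n : ℕ} (A : Finset (Finset (Fin n))) (B : Finset (Setoid (Fin n))) :
    SimpleGraph (A ⊕ B) where
  Adj
    | .inl a, .inr b => IsTransversal a.1 b.1
    | .inr b, .inl a => IsTransversal a.1 b.1
    | .inl _, .inl _ => False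
    | .inr _, .inr _ => False
  symm := ⟨by rintro (a | b) (a' | b') h <;> exact h⟩
  loopless := ⟨by rintro (a | b) h <;> exact h⟩

open Classical in
/-- The number `v₀(X)` of vertices in `X` of degree zero. -/
noncomputable def vZero {V : Type*} [Fintype V] (Γ : SimpleGraph V) (X : Finset V) : ℕ :=
  (X.filter fun x => Γ.degree x = 0).card

open Classical in
/-- The number `v₊(X)` of vertices in `X` of positive degree. -/
noncomputable def vPos {V : Type*} [Fintype V] (Γ : SimpleGraph V) (X : Finset V) : ℕ :=
  (X.filter fun x => 0 < Γ.degree x).card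

open Classical in
/-- The maximum degree of a vertex of a finite graph (zero if there are no vertices). -/
noncomputable def maxDeg {V : Type*} [Fintype V] (Γ : SimpleGraph V) : ℕ :=
  Γ.maxDegree

/-- The vertices of `Γ(A,B)` that lie in `A`. -/
def imageVertices {n : ℕ} (A : Finset (Finset (Fin n))) (B : Finset (Setoid (Fin n))) :
    Finset (A ⊕ B) :=
  Finset.univ.map Function.Embedding.inl

/-- The vertices of `Γ(A,B)` that lie in `B`. -/
def kernelVertices {n : ℕ} (A : Finset (Finset (Fin n))) (B : Finset (Setoid (Fin n))) :
    Finset (A ⊕ B) :=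
  Finset.univ.map Function.Embedding.inr

/-! A map with image `a` and kernel `b` is a triple (a, g, b), where g ∈ S_r matches the classes of
`b` with the points of `a`. The product (a, g, b)(a', g', b') has rank r exactly when `a'` is a
transversal of `b`, and then equals (a, g p g', b') with p depending only on `b` and `a'`. Modulo
maps of rank below r this is multiplication in a Rees matrix semigroup over S_r with zero
(`IsReesFamily`), and only elements of rank r matter for the rank of S(A,B).

Lower bounds come from factorising into generators. Given one edge of Γ, every image must begin some
generator with non-isolated kernel, and every isolated kernel needs a further generator; dually with
images and kernels exchanged. If Γ is a matching and the bound is attained, a word is determined by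
its length and its first image, so concatenating two words in either order gives the same element,
which contradicts non-commutativity of S_r (`card_left_lt`). Without edges no element of rank r is a
product.

For the upper bound, isolated vertices cost one generator each. On the rest, N generators are arcs
from images to kernels labelled in S_r, and edges of Γ are arcs back labelled by p; labels of walks
are elements generated. Matching tails with heads suitably makes the digraph strongly connected
(`exists_perm_transGen`). If Γ has fewer than N components there, at most N - 2 new arcs connect it,
and two spare arcs can be labelled to create loops with labels generating S_r (`exists_labels`). -/

/-! ### Connectivity of finite digraphs -/

open Relation in
/-- Exchanging the out-neighbourhoods of two cyclic vertices `x`, `y` with `y` not leading to `x`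
keeps all reachabilities and makes `x` reachable from `y`. -/
theorem transGen_swap_of_not_transGen {ι : Type*} [DecidableEq ι] {r : ι → ι → Prop} {x y : ι}
    (hx : TransGen r x x) (hy : TransGen r y y) (hyx : ¬ TransGen r y x) :
    TransGen (fun i j => r (Equiv.swap x y i) j) y x ∧
      ∀ i j, TransGen r i j → TransGen (fun i j => r (Equiv.swap x y i) j) i j := by
  set r' : ι → ι → Prop := fun i j => r (Equiv.swap x y i) j with hr'
  have other : ∀ i j, i ≠ x → i ≠ y → r i j → r' i j := by
    intro i j h1 h2 h
    simpa [hr', Equiv.swap_apply_of_ne_of_ne h1 h2] using h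
  have fromx : ∀ j, r x j → r' y j := fun j h => by simpa [hr'] using h
  have fromy : ∀ j, r y j → r' x j := fun j h => by simpa [hr'] using h
  -- A walk to `x`, cut at its first visit to `x`, uses no arc out of `x`, and none out of `y`
  -- because `y` does not lead to `x`. So it survives the exchange.
  have tox : ∀ i, ReflTransGen r i x → ReflTransGen r' i x := by
    intro i hi
    induction hi using ReflTransGen.head_induction_on with
    | refl => exact .refl
    | head h hk ih =>
      rename_i i k
      by_cases hix : i = x
      · subst hix; exact .refl
      by_cases hiy : i = y
      · subst hiy; exact absurd (TransGen.head' h hk) hyx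
      exact .head (other _ _ hix hiy h) ih
  -- Walks from a vertex reachable from `y` never meet `x`, for the same reason.
  have toy : ∀ i, ReflTransGen r i y → TransGen r y i → ReflTransGen r' i y := by
    intro i hi
    induction hi using ReflTransGen.head_induction_on with
    | refl => intro _; exact .refl
    | head h hk ih =>
      rename_i i k
      intro hyi
      by_cases hix : i = x
      · subst hix; exact absurd hyi hyx
      by_cases hiy : i = y
      · subst hiy; exact .refl
      exact .head (other _ _ hix hiy h) (ih (hyi.tail h))
  have yx : TransGen r' y x := by
    obtain ⟨j, hj, hjx⟩ := (TransGen.head'_iff).1 hx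
    exact TransGen.head' (fromx j hj) (tox j hjx)
  have xy : TransGen r' x y := by
    obtain ⟨j, hj, hjy⟩ := (TransGen.head'_iff).1 hy
    exact TransGen.head' (fromy j hj) (toy j hjy (.single hj))
  -- As `x` and `y` now reach each other, an old arc out of one is replaced by a detour through the
  -- other.
  have step : ∀ i j, r i j → TransGen r' i j := by
    intro i j h
    by_cases hix : i = x
    · subst hix; exact xy.tail (fromx j h)
    by_cases hiy : i = y
    · subst hiy; exact yx.tail (fromy j h)
    exact .single (other _ _ hix hiy h)
  refine ⟨yx, fun i j h => ?_⟩
  induction h with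
  | single h => exact step _ _ h
  | tail _ h ih => exact ih.trans (step _ _ h)

open Relation in
/-- In a finite digraph without sinks every vertex leads to a cyclic vertex. -/
theorem exists_transGen_cyclic {ι : Type*} [Finite ι] {r : ι → ι → Prop}
    (h : ∀ i, ∃ j, r i j) (i : ι) : ∃ c, TransGen r i c ∧ TransGen r c c := by
  choose f hf using h
  have hit : ∀ (k : ℕ) (x : ι), TransGen r x (f^[k + 1] x) := by
    intro k
    induction k with
    | zero => intro x; exact .single (hf x)
    | succ k ih =>
      intro x
      rw [Function.iterate_succ_apply']
      exact (ih x).tail (hf _)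
  obtain ⟨m, k, hmk, he⟩ := Finite.exists_ne_map_eq_of_infinite (fun k : ℕ => f^[k + 1] i)
  wlog hlt : m < k generalizing m k
  · exact this k m hmk.symm he.symm (by omega)
  refine ⟨f^[m + 1] i, hit m i, ?_⟩
  obtain ⟨d, rfl⟩ := Nat.exists_eq_add_of_lt hlt
  have := hit d (f^[m + 1] i)
  rw [← Function.iterate_add_apply] at this
  have e : d + 1 + (m + 1) = m + d + 1 + 1 := by omega
  rw [e] at this
  rw [← he] at this
  exact this

open Relation in
/-- A left- and right-total relation on a finite type becomes strongly connected after a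
suitable permutation of its sources. -/
theorem exists_perm_transGen {ι : Type*} [Finite ι] (R : ι → ι → Prop)
    (hl : ∀ i, ∃ j, R i j) (hr : ∀ j, ∃ i, R i j) :
    ∃ σ : Equiv.Perm ι, ∀ i j, TransGen (fun i j => R (σ i) j) i j := by
  classical
  -- Extremal choice: as many reachable pairs as possible. Two cyclic vertices not leading to each
  -- other would allow an exchange that gains a pair.
  obtain ⟨σ, hσ⟩ := Finite.exists_max
    (fun σ : Equiv.Perm ι => {q : ι × ι | TransGen (fun i j => R (σ i) j) q.1 q.2}.ncard)
  refine ⟨σ, ?_⟩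
  set r : ι → ι → Prop := fun i j => R (σ i) j with hrdef
  have cyc : ∀ x y, TransGen r x x → TransGen r y y → TransGen r y x := by
    intro x y hx hy
    by_contra hyx
    obtain ⟨h1, h2⟩ := transGen_swap_of_not_transGen hx hy hyx
    have hmax := hσ (σ * Equiv.swap x y)
    refine absurd hmax (not_le.2 (Set.ncard_lt_ncard ?_ (Set.toFinite _)))
    refine ⟨fun q hq => h2 q.1 q.2 hq, fun hsub => hyx ?_⟩
    exact hsub (a := (y, x)) h1
  have hl' : ∀ i, ∃ j, r i j := fun i => hl (σ i)
  have hr' : ∀ j, ∃ i, r i j := fun j => by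
    obtain ⟨i, hi⟩ := hr j
    exact ⟨σ.symm i, by simpa [hrdef] using hi⟩
  have all : ∀ i, TransGen r i i := by
    intro i
    obtain ⟨c, hic, hc⟩ := exists_transGen_cyclic hl' i
    obtain ⟨d, hid, hd⟩ := exists_transGen_cyclic (r := Function.swap r) hr' i
    rw [transGen_swap] at hid hd
    exact (hic.trans (cyc d c hd hc)).trans hid
  exact fun i j => cyc j i (all j) (all i)

open Relation in
/-- If an equivalence relation `r` together with some arcs connects `V`, then fewer arcs than
classes of `r` suffice. -/
theorem exists_finset_connecting {V ι : Type*} [Finite V] [Nonempty V] (r : Setoid V)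
    (s t : ι → V)
    (h : ∀ v w, EqvGen (fun x y => r x y ∨ ∃ i, x = s i ∧ y = t i) v w) :
    ∃ T : Finset ι, T.card + 1 ≤ Nat.card (Quotient r) ∧
      ∀ v w, EqvGen (fun x y => r x y ∨ ∃ i ∈ T, x = s i ∧ y = t i) v w := by
  classical
  have : Fintype (Quotient r) := Fintype.ofFinite _
  let H : SimpleGraph (Quotient r) :=
    SimpleGraph.fromRel fun c d => ∃ i, c = Quotient.mk r (s i) ∧ d = Quotient.mk r (t i)
  have hreach : ∀ v w, H.Reachable (Quotient.mk r v) (Quotient.mk r w) := by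
    intro v w
    induction h v w with
    | rel x y hxy =>
      rcases hxy with hxy | ⟨i, rfl, rfl⟩
      · rw [Quotient.sound hxy]
      · by_cases he : Quotient.mk r (s i) = Quotient.mk r (t i)
        · rw [he]
        · exact SimpleGraph.Adj.reachable ((SimpleGraph.fromRel_adj _ _ _).2 ⟨he, .inl ⟨i, rfl, rfl⟩⟩)
    | refl x => exact .refl _
    | symm _ _ _ ih => exact ih.symm
    | trans _ _ _ _ _ ih1 ih2 => exact ih1.trans ih2
  have hconn : H.Connected :=
    { preconnected := fun c d => by
        induction c using Quotient.inductionOn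
        induction d using Quotient.inductionOn
        exact hreach _ _
      nonempty := ⟨Quotient.mk r (Classical.arbitrary V)⟩ }
  -- One arc for each edge of a spanning tree of the quotient is enough.
  obtain ⟨F, hFH, hF⟩ := hconn.exists_isTree_le
  have key : ∀ e ∈ F.edgeFinset, ∃ i, e = s(Quotient.mk r (s i), Quotient.mk r (t i)) := by
    intro e he
    induction e using Sym2.inductionOn with
    | hf c d =>
      have hcd : H.Adj c d := hFH (by simpa using he)
      rcases ((SimpleGraph.fromRel_adj _ _ _).1 hcd).2 with ⟨i, rfl, rfl⟩ | ⟨i, rfl, rfl⟩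
      · exact ⟨i, rfl⟩
      · exact ⟨i, Sym2.eq_swap⟩
  choose f hf using key
  let T : Finset ι := F.edgeFinset.attach.image fun e => f e.1 e.2
  refine ⟨T, ?_, ?_⟩
  · have h1 : T.card ≤ F.edgeFinset.card := by
      simpa using Finset.card_image_le (s := F.edgeFinset.attach) (f := fun e => f e.1 e.2)
    have h2 := hF.card_edgeFinset
    rw [Nat.card_eq_fintype_card]
    omega
  · have hrel : ∀ v w, r v w → EqvGen (fun x y => r x y ∨ ∃ i ∈ T, x = s i ∧ y = t i) v w :=
      fun v w h => .rel _ _ (.inl h)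
    have hwalk : ∀ c d, F.Reachable c d → ∀ v w, Quotient.mk r v = c → Quotient.mk r w = d →
        EqvGen (fun x y => r x y ∨ ∃ i ∈ T, x = s i ∧ y = t i) v w := by
      rintro c d ⟨p⟩
      induction p with
      | nil =>
        rintro v w rfl h
        exact hrel _ _ (Quotient.exact h.symm)
      | cons hadj p ih =>
        rename_i a b c
        rintro v w rfl rfl
        have he := (SimpleGraph.mem_edgeFinset (G := F)).2 ((SimpleGraph.mem_edgeSet F).2 hadj)
        have hfe := hf _ he
        have hT : f _ he ∈ T := Finset.mem_image.2 ⟨⟨_, he⟩, Finset.mem_attach _ _, rfl⟩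
        generalize f _ he = i at hfe hT
        have harc : EqvGen (fun x y => r x y ∨ ∃ i ∈ T, x = s i ∧ y = t i) (s i) (t i) :=
          .rel _ _ (.inr ⟨i, hT, rfl, rfl⟩)
        rcases Sym2.eq_iff.1 hfe with ⟨h1, h2⟩ | ⟨h1, h2⟩
        · exact ((hrel _ _ (Quotient.exact h1)).trans _ _ _ harc).trans _ _ _ (ih _ _ h2.symm rfl)
        · exact ((hrel _ _ (Quotient.exact h1)).trans _ _ _ (harc.symm _ _)).trans _ _ _
            (ih _ _ h2.symm rfl)
    exact fun v w => hwalk _ _ (hF.connected.preconnected _ _) v w rfl rfl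

/-! ### Walks with labels in a finite group -/

/-- `LabelledWalk E x y g`: there is a walk from `x` to `y` along arcs of `E` whose labels
multiply to `g`. -/
inductive LabelledWalk {V G : Type*} [Group G] (E : V → V → G → Prop) : V → V → G → Prop
  | nil (x : V) : LabelledWalk E x x 1
  | cons {x y z : V} {g h : G} : E x y g → LabelledWalk E y z h → LabelledWalk E x z (g * h)

namespace LabelledWalk

variable {V G : Type*} [Group G] {E F : V → V → G → Prop} {x y z : V} {g h : G}

theorem of_arc (hE : E x y g) : LabelledWalk E x y g := by
  simpa using cons hE (nil y)

theorem trans (h1 : LabelledWalk E x y g) (h2 : LabelledWalk E y z h) :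
    LabelledWalk E x z (g * h) := by
  induction h1 with
  | nil => simpa using h2
  | cons hE _ ih => rw [mul_assoc]; exact cons hE (ih h2)

theorem pow (h1 : LabelledWalk E x x g) (k : ℕ) : LabelledWalk E x x (g ^ k) := by
  induction k with
  | zero => simpa using nil x
  | succ k ih => rw [pow_succ]; exact ih.trans h1

theorem bind (hEF : ∀ x y g, E x y g → LabelledWalk F x y g) (h1 : LabelledWalk E x y g) :
    LabelledWalk F x y g := by
  induction h1 with
  | nil => exact nil _
  | cons hE _ ih => exact (hEF _ _ _ hE).trans ih

theorem symm_of_arcs (hE : ∀ x y g, E x y g → LabelledWalk E y x g⁻¹)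
    (h1 : LabelledWalk E x y g) : LabelledWalk E y x g⁻¹ := by
  induction h1 with
  | nil => simpa using nil _
  | cons h _ ih => rw [mul_inv_rev]; exact ih.trans (hE _ _ _ h)

/-- With labels in a finite group, walks in a strongly connected digraph can be reversed. -/
theorem symm [Finite G] (hE : ∀ x y, ∃ g, LabelledWalk E x y g) (h1 : LabelledWalk E x y g) :
    LabelledWalk E y x g⁻¹ := by
  obtain ⟨h, hh⟩ := hE y x
  -- Return to `x` with label `h`, then run round the loop `g * h` until it contributes its inverse:
  -- `h * (g * h)⁻¹ = g⁻¹`.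
  have h2 := hh.trans ((h1.trans hh).pow (orderOf (g * h) - 1))
  have : (g * h) ^ (orderOf (g * h) - 1) = (g * h)⁻¹ := by
    rw [eq_inv_iff_mul_eq_one, ← pow_succ, Nat.sub_add_cancel (orderOf_pos _), pow_orderOf_eq_one]
  rw [this] at h2
  simpa using h2

end LabelledWalk

open Relation in
/-- In a strongly connected digraph with some arcs `E` already labelled in a finite group
generated by `u` and `v`, the remaining arcs can be labelled such that every group element is
the label of a walk between any two vertices, as soon as two of them are not needed to
connect the underlying graph. -/
theorem exists_labels {V G ι : Type*} [Group G] [Finite G]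
    (E : V → V → G → Prop) (s t : ι → V) (T : Finset ι) {i j : ι} (hi : i ∉ T) (hj : j ∉ T)
    (hij : i ≠ j) {u v : G} (huv : Subgroup.closure {u, v} = ⊤)
    (hT : ∀ x y, EqvGen (fun x y => (∃ g, E x y g) ∨ ∃ k ∈ T, x = s k ∧ y = t k) x y)
    (hs : ∀ x y, ReflTransGen (fun x y => (∃ g, E x y g) ∨ ∃ k, x = s k ∧ y = t k) x y) :
    ∃ g : ι → G, ∀ x y h,
      LabelledWalk (fun x y h => E x y h ∨ ∃ k, x = s k ∧ y = t k ∧ h = g k) x y h := by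
  classical
  let F : V → V → G → Prop := fun x y h => E x y h ∨ ∃ k ∈ T, x = s k ∧ y = t k ∧ h = 1
  let F' : V → V → G → Prop := fun x y h => F x y h ∨ F y x h⁻¹
  have hF' : ∀ x y, ∃ h, LabelledWalk F' x y h := by
    intro x y
    induction hT x y with
    | rel x y h =>
      rcases h with ⟨g, hg⟩ | ⟨k, hk, rfl, rfl⟩
      · exact ⟨g, .of_arc (.inl (.inl hg))⟩
      · exact ⟨1, .of_arc (.inl (.inr ⟨k, hk, rfl, rfl, rfl⟩))⟩
    | refl x => exact ⟨1, .nil x⟩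
    | symm _ _ _ ih =>
      obtain ⟨h, hh⟩ := ih
      refine ⟨h⁻¹, hh.symm_of_arcs fun x y g hg => .of_arc ?_⟩
      rcases hg with hg | hg
      · exact .inr (by simpa using hg)
      · exact .inl hg
    | trans _ _ _ _ _ ih1 ih2 =>
      obtain ⟨h1, hh1⟩ := ih1
      obtain ⟨h2, hh2⟩ := ih2
      exact ⟨_, hh1.trans hh2⟩
  let x₀ : V := s i
  -- A potential: the label of an undirected walk from `x₀` to `x` that avoids the spare arcs `i`
  -- and `j`, whose labels are still free.
  choose φ hφ using fun x => hF' x₀ x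
  -- The loop from `x₀` through arc `i` and back along the potential then has label `u`, and that
  -- through `j` has label `v`.
  let g : ι → G := fun k =>
    if k = i then (φ (s k))⁻¹ * u * φ (t k) else if k = j then (φ (s k))⁻¹ * v * φ (t k) else 1
  have gi : g i = (φ (s i))⁻¹ * u * φ (t i) := by simp [g]
  have gj : g j = (φ (s j))⁻¹ * v * φ (t j) := by simp [g, hij.symm]
  have gT : ∀ k ∈ T, g k = 1 := by
    intro k hk
    have h1 : k ≠ i := fun h => hi (h ▸ hk)
    have h2 : k ≠ j := fun h => hj (h ▸ hk)
    simp [g, h1, h2]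
  refine ⟨g, ?_⟩
  set D : V → V → G → Prop := fun x y h => E x y h ∨ ∃ k, x = s k ∧ y = t k ∧ h = g k with hD
  have strong : ∀ x y, ∃ h, LabelledWalk D x y h := by
    intro x y
    induction hs x y with
    | refl => exact ⟨1, .nil x⟩
    | tail _ h ih =>
      obtain ⟨a, ha⟩ := ih
      rcases h with ⟨b, hb⟩ | ⟨k, rfl, rfl⟩
      · exact ⟨_, ha.trans (.of_arc (.inl hb))⟩
      · exact ⟨_, ha.trans (.of_arc (.inr ⟨k, rfl, rfl, rfl⟩))⟩
  have hFD : ∀ x y h, F x y h → LabelledWalk D x y h := by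
    rintro x y h (h | ⟨k, hk, rfl, rfl, rfl⟩)
    · exact .of_arc (.inl h)
    · exact .of_arc (.inr ⟨k, rfl, rfl, (gT k hk).symm⟩)
  -- Backward steps are replaced by directed walks with the inverse label, by strong connectivity
  -- and finiteness of `G`.
  have hφD : ∀ x, LabelledWalk D x₀ x (φ x) := fun x => (hφ x).bind <| by
    rintro x y h (h | h)
    · exact hFD _ _ _ h
    · simpa using (hFD _ _ _ h).symm strong
  let K : Subgroup G :=
    { carrier := {h | LabelledWalk D x₀ x₀ h}
      one_mem' := .nil _
      mul_mem' := fun h1 h2 => LabelledWalk.trans h1 h2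
      inv_mem' := fun h1 => LabelledWalk.symm strong h1 }
  have loop : ∀ k w, g k = (φ (s k))⁻¹ * w * φ (t k) → w ∈ K := by
    intro k w hk
    have := ((hφD (s k)).trans (.of_arc (.inr ⟨k, rfl, rfl, hk.symm⟩))).trans
      ((hφD (t k)).symm strong)
    have e : φ (s k) * ((φ (s k))⁻¹ * w * φ (t k)) * (φ (t k))⁻¹ = w := by group
    rw [e] at this
    exact this
  have hK : K = ⊤ := by
    rw [eq_top_iff, ← huv, Subgroup.closure_le]
    rintro w (rfl | rfl)
    · exact loop i _ gi
    · exact loop j _ gj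
  intro x y h
  have hk : φ x * h * (φ y)⁻¹ ∈ K := by rw [hK]; trivial
  have := (((hφD x).symm strong).trans hk).trans (hφD y)
  have e : (φ x)⁻¹ * (φ x * h * (φ y)⁻¹) * φ y = h := by group
  rwa [e] at this

/-! ### Rees families and lower bounds for generating sets -/

/-- The elements `mk a g b` of the semigroup `M` multiply as in a Rees matrix semigroup over the
group `G` with sandwich matrix `p`, up to an ideal `Z` containing the products that correspond
to zero. -/
structure IsReesFamily {M A B G : Type*} [Semigroup M] [Group G] (mk : A → G → B → M)
    (p : B → A → G) (adj : B → A → Prop) (Z : Set M) : Prop where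
  inj : ∀ {a g b a' g' b'}, mk a g b = mk a' g' b' → a = a' ∧ g = g' ∧ b = b'
  mul : ∀ {a g b a' g' b'}, adj b a' → mk a g b * mk a' g' b' = mk a (g * p b a' * g') b'
  zero : ∀ {a g b a' g' b'}, ¬ adj b a' → mk a g b * mk a' g' b' ∈ Z
  left : ∀ {z m}, z ∈ Z → z * m ∈ Z
  right : ∀ {z m}, z ∈ Z → m * z ∈ Z
  notMem : ∀ {a g b}, mk a g b ∉ Z

/-- `ReesWord mk p adj X k a g b`: `mk a g b` is a nonzero product of `k` elements of `X`. -/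
inductive ReesWord {M A B G : Type*} [Semigroup M] [Group G] (mk : A → G → B → M)
    (p : B → A → G) (adj : B → A → Prop) (X : Set M) : ℕ → A → G → B → Prop
  | single {a g b} : mk a g b ∈ X → ReesWord mk p adj X 1 a g b
  | cons {k a g b a' g' b'} : mk a g b ∈ X → adj b a' → ReesWord mk p adj X k a' g' b' →
      ReesWord mk p adj X (k + 1) a (g * p b a' * g') b'

/-- The set of all elements of a family indexed by triples. -/
def reesRange {M A B G : Type*} (mk : A → G → B → M) : Set M := {m | ∃ a g b, m = mk a g b}

namespace ReesWord

variable {M A B G : Type*} [Semigroup M] [Group G] {mk : A → G → B → M}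
  {p : B → A → G} {adj : B → A → Prop} {X : Set M}

theorem append {k l a g b a' g' b'} (h1 : ReesWord mk p adj X k a g b) (h : adj b a')
    (h2 : ReesWord mk p adj X l a' g' b') :
    ReesWord mk p adj X (k + l) a (g * p b a' * g') b' := by
  induction h1 with
  | single hm => rw [add_comm]; exact cons hm h h2
  | cons hm hadj _ ih =>
    rename_i k a g b a₁ g₁ b₁ h₁
    have e : g * p b a₁ * g₁ * p b₁ a' * g' = g * p b a₁ * (g₁ * p b₁ a' * g') := by
      simp only [mul_assoc]
    rw [e, show k + 1 + l = k + l + 1 by omega]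
    exact cons hm hadj (ih h)

/-- The first factor of a word. -/
theorem exists_head {k a g b} (h : ReesWord mk p adj X k a g b) (hb : ∃ a', adj b a') :
    ∃ g' b', mk a g' b' ∈ X ∧ ∃ a', adj b' a' := by
  cases h with
  | single hm => exact ⟨_, _, hm, hb⟩
  | cons hm hadj _ => exact ⟨_, _, hm, _, hadj⟩

/-- The last factor of a word. -/
theorem exists_last {k a g b} (h : ReesWord mk p adj X k a g b) (ha : ∃ b', adj b' a) :
    ∃ a' g', mk a' g' b ∈ X ∧ ∃ b', adj b' a' := by
  induction h with
  | single hm => exact ⟨_, _, hm, ha⟩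
  | cons hm hadj _ ih => exact ih ⟨_, hadj⟩

/-- If each `a` is the first coordinate of at most one useful element of `X` and each `b` is
adjacent to at most one `a`, words are determined by their length and first coordinate. -/
theorem unique
    (hX : ∀ a g b g' b', mk a g b ∈ X → (∃ c, adj b c) → mk a g' b' ∈ X → (∃ c, adj b' c) →
      g = g' ∧ b = b')
    (hadj : ∀ b a a', adj b a → adj b a' → a = a') {k a g b g' b'}
    (h1 : ReesWord mk p adj X k a g b) (h2 : ReesWord mk p adj X k a g' b')
    (hb : ∃ c, adj b c) (hb' : ∃ c, adj b' c) : g = g' ∧ b = b' := by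
  induction h1 generalizing g' b' with
  | single hm =>
    cases h2 with
    | single hm' => exact hX _ _ _ _ _ hm hb hm' hb'
    | cons hm' had' hw' => cases hw'
  | cons hm had hw ih =>
    cases h2 with
    | single hm' => cases hw
    | cons hm' had' hw' =>
      obtain ⟨rfl, rfl⟩ := hX _ _ _ _ _ hm ⟨_, had⟩ hm' ⟨_, had'⟩
      obtain rfl := hadj _ _ _ had had'
      obtain ⟨rfl, rfl⟩ := ih hw' hb hb'
      exact ⟨rfl, rfl⟩

end ReesWord

namespace IsReesFamily

variable {M A B G : Type*} [Semigroup M] [Group G] {mk : A → G → B → M}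
  {p : B → A → G} {adj : B → A → Prop} {Z : Set M}

theorem mem_closure (H : IsReesFamily mk p adj Z) {m : M}
    (hm : m ∈ Subsemigroup.closure (reesRange mk)) : m ∈ Z ∨ ∃ a g b, m = mk a g b := by
  induction hm using Subsemigroup.closure_induction with
  | mem x hx => exact .inr hx
  | mul x y _ _ hx hy =>
    rcases hx with hx | ⟨a, g, b, rfl⟩
    · exact .inl (H.left hx)
    rcases hy with hy | ⟨a', g', b', rfl⟩
    · exact .inl (H.right hy)
    by_cases h : adj b a'
    · exact .inr ⟨_, _, _, H.mul h⟩
    · exact .inl (H.zero h)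

/-- As `Z` is an ideal disjoint from the family, a factorisation of a family element has no factor
in `Z` and no consecutive factors multiplying into `Z`. -/
theorem exists_word (H : IsReesFamily mk p adj Z) {X : Set M}
    (hX : X ⊆ Subsemigroup.closure (reesRange mk)) {a g b}
    (hm : mk a g b ∈ Subsemigroup.closure X) : ∃ k, ReesWord mk p adj X k a g b := by
  have hle : Subsemigroup.closure X ≤ Subsemigroup.closure (reesRange mk) :=
    Subsemigroup.closure_le.2 hX
  suffices h : ∀ m ∈ Subsemigroup.closure X, ∀ a g b, m = mk a g b →
      ∃ k, ReesWord mk p adj X k a g b from h _ hm _ _ _ rfl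
  intro m hm
  induction hm using Subsemigroup.closure_induction with
  | mem x hx =>
    rintro a g b rfl
    exact ⟨1, .single hx⟩
  | mul x y hx hy ihx ihy =>
    intro a g b he
    rcases H.mem_closure (hle hx) with hz | ⟨a₁, g₁, b₁, rfl⟩
    · exact absurd (he ▸ H.left hz) H.notMem
    rcases H.mem_closure (hle hy) with hz | ⟨a₂, g₂, b₂, rfl⟩
    · exact absurd (he ▸ H.right hz) H.notMem
    by_cases h : adj b₁ a₂
    · rw [H.mul h] at he
      obtain ⟨rfl, rfl, rfl⟩ := H.inj he
      obtain ⟨k, hk⟩ := ihx _ _ _ rfl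
      obtain ⟨l, hl⟩ := ihy _ _ _ rfl
      exact ⟨_, hk.append h hl⟩
    · exact absurd (he ▸ H.zero h) H.notMem

theorem exists_word_of_closure_eq (H : IsReesFamily mk p adj Z) {X : Set M}
    (hX : Subsemigroup.closure X = Subsemigroup.closure (reesRange mk)) (a g b) :
    ∃ k, ReesWord mk p adj X k a g b := by
  refine H.exists_word (hX ▸ Subsemigroup.subset_closure) ?_
  rw [hX]
  exact Subsemigroup.subset_closure ⟨a, g, b, rfl⟩

/-- Without nonzero products every element of the family is needed in a generating set. -/
theorem range_subset (H : IsReesFamily mk p adj Z) (hadj : ∀ b a, ¬ adj b a) {X : Set M}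
    (hX : Subsemigroup.closure X = Subsemigroup.closure (reesRange mk)) : reesRange mk ⊆ X := by
  rintro _ ⟨a, g, b, rfl⟩
  obtain ⟨k, hk⟩ := H.exists_word_of_closure_eq hX a g b
  cases hk with
  | single h => exact h
  | cons _ h _ => exact absurd h (hadj _ _)

/-- All `a`s and all isolated `b`s occur as coordinates of distinct generators. -/
theorem exists_injection_left (H : IsReesFamily mk p adj Z) {X : Set M}
    (hX : Subsemigroup.closure X = Subsemigroup.closure (reesRange mk))
    {b₀ a₀} (h₀ : adj b₀ a₀) :
    ∃ f : A ⊕ {b : B // ∀ a, ¬ adj b a} → X, Function.Injective f ∧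
      (∀ a, ∃ g b, (f (.inl a) : M) = mk a g b) ∧ ∀ b, ∃ a g, (f (.inr b) : M) = mk a g b := by
  -- The first letter of a word ending in the non-isolated `b₀` has non-isolated second coordinate:
  -- it is either the whole word or followed by another letter. Hence it differs from every
  -- generator chosen for an isolated `b`.
  have h1 : ∀ a, ∃ g b, mk a g b ∈ X ∧ ∃ a', adj b a' := fun a => by
    obtain ⟨k, hk⟩ := H.exists_word_of_closure_eq hX a 1 b₀
    exact hk.exists_head ⟨_, h₀⟩
  have h2 : ∀ b, ∃ a g, mk a g b ∈ X ∧ ∃ b', adj b' a := fun b => by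
    obtain ⟨k, hk⟩ := H.exists_word_of_closure_eq hX a₀ 1 b
    exact hk.exists_last ⟨_, h₀⟩
  choose g b hgb hb using h1
  choose a g' hag _ using h2
  refine ⟨Sum.elim (fun x => ⟨_, hgb x⟩) (fun y => ⟨_, hag y.1⟩), ?_, fun x => ⟨_, _, rfl⟩,
    fun y => ⟨_, _, rfl⟩⟩
  rintro (x | x) (y | y) hxy <;> have hxy := Subtype.ext_iff.1 hxy
  · rw [(H.inj hxy).1]
  · obtain ⟨c, hc⟩ := hb x
    exact absurd ((H.inj hxy).2.2 ▸ hc) (y.2 c)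
  · obtain ⟨c, hc⟩ := hb y
    exact absurd ((H.inj hxy).2.2 ▸ hc) (x.2 c)
  · rw [Subtype.ext (H.inj hxy).2.2]

theorem card_left_le [Finite A] [Finite B] (H : IsReesFamily mk p adj Z)
    {X : Finset M}
    (hX : Subsemigroup.closure (X : Set M) = Subsemigroup.closure (reesRange mk))
    {b₀ a₀} (h₀ : adj b₀ a₀) :
    Nat.card A + Nat.card {b : B // ∀ a, ¬ adj b a} ≤ X.card := by
  obtain ⟨f, hf, -⟩ := H.exists_injection_left hX h₀
  have := Nat.card_le_card_of_injective f hf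
  simpa [Nat.card_sum] using this

/-- The dual count: last letters of words starting in `a₀` have non-isolated first coordinate. -/
theorem card_right_le [Finite A] [Finite B] (H : IsReesFamily mk p adj Z)
    {X : Finset M}
    (hX : Subsemigroup.closure (X : Set M) = Subsemigroup.closure (reesRange mk))
    {b₀ a₀} (h₀ : adj b₀ a₀) :
    Nat.card B + Nat.card {a : A // ∀ b, ¬ adj b a} ≤ X.card := by
  have h1 : ∀ a, ∃ g b, mk a g b ∈ (X : Set M) ∧ ∃ a', adj b a' := fun a => by
    obtain ⟨k, hk⟩ := H.exists_word_of_closure_eq hX a 1 b₀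
    exact hk.exists_head ⟨_, h₀⟩
  have h2 : ∀ b, ∃ a g, mk a g b ∈ (X : Set M) ∧ ∃ b', adj b' a := fun b => by
    obtain ⟨k, hk⟩ := H.exists_word_of_closure_eq hX a₀ 1 b
    exact hk.exists_last ⟨_, h₀⟩
  choose g b hgb _ using h1
  choose a g' hag ha using h2
  let f : B ⊕ {a : A // ∀ b, ¬ adj b a} → (X : Set M) :=
    Sum.elim (fun x => ⟨_, hag x⟩) (fun y => ⟨_, hgb y.1⟩)
  have hf : Function.Injective f := by
    rintro (x | x) (y | y) hxy <;> have hxy := Subtype.ext_iff.1 hxy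
    · rw [(H.inj hxy).2.2]
    · obtain ⟨c, hc⟩ := ha x
      exact absurd ((H.inj hxy).1 ▸ hc) (y.2 c)
    · obtain ⟨c, hc⟩ := ha y
      exact absurd ((H.inj hxy).1 ▸ hc) (x.2 c)
    · rw [Subtype.ext (H.inj hxy).1]
  have := Nat.card_le_card_of_injective f hf
  simpa [Nat.card_sum] using this

/-- When adjacency is a partial matching and `G` is not commutative, one more generator is
needed. -/
theorem card_left_lt [Finite A] [Finite B] (H : IsReesFamily mk p adj Z)
    {X : Finset M}
    (hX : Subsemigroup.closure (X : Set M) = Subsemigroup.closure (reesRange mk))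
    {b₀ a₀} (h₀ : adj b₀ a₀) (hadj : ∀ b a a', adj b a → adj b a' → a = a')
    (hG : ∃ g h : G, g * h ≠ h * g) :
    Nat.card A + Nat.card {b : B // ∀ a, ¬ adj b a} < X.card := by
  refine lt_of_le_of_ne (H.card_left_le hX h₀) fun hcard => ?_
  obtain ⟨f, hf, hfa, hfb⟩ := H.exists_injection_left hX h₀
  have hbij : Function.Bijective f := by
    refine (Nat.bijective_iff_injective_and_card f).2 ⟨hf, ?_⟩
    simpa [Nat.card_sum] using hcard
  -- With equality the injection exhausts `X`, so the only generator with first coordinate `a` and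
  -- non-isolated second coordinate is the one chosen for `a`.
  have hun : ∀ a g b g' b', mk a g b ∈ (X : Set M) → (∃ c, adj b c) →
      mk a g' b' ∈ (X : Set M) → (∃ c, adj b' c) → g = g' ∧ b = b' := by
    have key : ∀ a g b, mk a g b ∈ (X : Set M) → (∃ c, adj b c) →
        mk a g b = f (.inl a) := by
      rintro a g b hm ⟨c, hc⟩
      obtain ⟨x | y, hz⟩ := hbij.2 ⟨_, hm⟩
      · obtain ⟨g', b', h'⟩ := hfa x
        rw [hz] at h'
        obtain rfl := (H.inj h').1
        rw [hz]
      · obtain ⟨a', g', h'⟩ := hfb y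
        rw [hz] at h'
        exact absurd ((H.inj h').2.2 ▸ hc) (y.2 c)
    intro a g b g' b' hm hb hm' hb'
    exact (H.inj ((key _ _ _ hm hb).trans (key _ _ _ hm' hb').symm)).2
  obtain ⟨g, h, hgh⟩ := hG
  -- The correction cancels the sandwich entry: the two concatenations have equal length and start,
  -- but group parts `g * h * (p b₀ a₀)⁻¹` and `h * g * (p b₀ a₀)⁻¹`.
  obtain ⟨k, hk⟩ := H.exists_word_of_closure_eq hX a₀ (g * (p b₀ a₀)⁻¹) b₀
  obtain ⟨l, hl⟩ := H.exists_word_of_closure_eq hX a₀ (h * (p b₀ a₀)⁻¹) b₀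
  have h1 := hk.append h₀ hl
  have h2 := hl.append h₀ hk
  rw [add_comm] at h2
  have := (ReesWord.unique hun hadj h1 h2 ⟨_, h₀⟩ ⟨_, h₀⟩).1
  apply hgh
  simpa [← mul_assoc] using this

end IsReesFamily

/-! ### Completing a bipartite graph to a strongly connected digraph -/

/-- The arcs from `Λ` to `I` of a bipartite digraph. -/
def bipartiteArcs {I Λ : Type*} (P : Λ → I → Prop) : I ⊕ Λ → I ⊕ Λ → Prop :=
  fun x y => ∃ l i, x = .inr l ∧ y = .inl i ∧ P l i

/-- The number of connected components of a bipartite graph without isolated vertices is less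
than `N` if both parts have at most `N` vertices, unless both have exactly `N` and the graph
is a perfect matching. -/
theorem card_quotient_bipartite_lt {I Λ : Type*} [Finite I] [Finite Λ] {P : Λ → I → Prop}
    (hI : ∀ i, ∃ l, P l i) (hΛ : ∀ l, ∃ i, P l i) {N : ℕ} (hIN : Nat.card I ≤ N)
    (hΛN : Nat.card Λ ≤ N)
    (h : Nat.card I < N ∨ (∃ l i i', P l i ∧ P l i' ∧ i ≠ i') ∨
      ∃ i l l', P l i ∧ P l' i ∧ l ≠ l') :
    Nat.card (Quotient (Relation.EqvGen.setoid (bipartiteArcs P))) < N := by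
  set r := Relation.EqvGen.setoid (bipartiteArcs P)
  have hr : ∀ l i, P l i → Quotient.mk r (.inr l) = Quotient.mk r (.inl i) := fun l i hli =>
    Quotient.sound (Relation.EqvGen.rel _ _ ⟨l, i, rfl, rfl, hli⟩)
  let f : I → Quotient r := fun i => Quotient.mk r (.inl i)
  let g : Λ → Quotient r := fun l => Quotient.mk r (.inr l)
  have hf : Function.Surjective f := by
    intro q
    induction q using Quotient.inductionOn with
    | h v =>
      rcases v with i | l
      · exact ⟨i, rfl⟩
      · obtain ⟨i, hi⟩ := hΛ l
        exact ⟨i, (hr l i hi).symm⟩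
  have hg : Function.Surjective g := by
    intro q
    induction q using Quotient.inductionOn with
    | h v =>
      rcases v with i | l
      · obtain ⟨l, hl⟩ := hI i
        exact ⟨l, hr l i hl⟩
      · exact ⟨l, rfl⟩
  have hfc := Nat.card_le_card_of_surjective f hf
  have hgc := Nat.card_le_card_of_surjective g hg
  -- Every component meets both parts. With at least `N` components both maps to components are
  -- bijective, which excludes a small part and any branching.
  by_contra hN
  have hf' : Function.Injective f :=
    ((Nat.bijective_iff_surjective_and_card f).2 ⟨hf, by omega⟩).1
  have hg' : Function.Injective g :=
    ((Nat.bijective_iff_surjective_and_card g).2 ⟨hg, by omega⟩).1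
  rcases h with h | ⟨l, i, i', h1, h2, hne⟩ | ⟨i, l, l', h1, h2, hne⟩
  · omega
  · exact hne (hf' ((hr l i h1).symm.trans (hr l i' h2)))
  · exact hne (hg' ((hr l i h1).trans (hr l' i h2).symm))

theorem exists_surjective_fin {I : Type*} [Finite I] [Nonempty I] {N : ℕ} (h : Nat.card I ≤ N) :
    ∃ f : Fin N → I, Function.Surjective f := by
  have : Fintype I := Fintype.ofFinite I
  obtain ⟨e⟩ := Function.Embedding.nonempty_of_card_le (α := I) (β := Fin N)
    (by simpa [Nat.card_eq_fintype_card] using h)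
  exact ⟨Function.invFun e, Function.invFun_surjective e.injective⟩

open Relation in
/-- In a bipartite graph without isolated vertices on `I ⊕ Λ`, with edges directed from `Λ` to
`I`, one can add arcs from `I` to `Λ` whose tails and heads are prescribed up to matching
them, such that the resulting digraph is strongly connected. -/
theorem exists_perm_strongly_connected {I Λ ι : Type*} [Finite ι] {P : Λ → I → Prop}
    (hI : ∀ i, ∃ l, P l i) (hΛ : ∀ l, ∃ i, P l i) {s : ι → I} {t : ι → Λ}
    (hs : Function.Surjective s) (ht : Function.Surjective t) :
    ∃ σ : Equiv.Perm ι, ∀ x y, ReflTransGen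
      (fun x y => bipartiteArcs P x y ∨ ∃ k, x = .inl (s k) ∧ y = .inr (t (σ k))) x y := by
  -- The digraph lemma is applied to the arcs to be added: one can follow another if the head of the
  -- first is adjacent to the tail of the second.
  obtain ⟨σ, hσ⟩ := exists_perm_transGen (fun k l => P (t k) (s l))
    (fun k => by
      obtain ⟨i, hi⟩ := hΛ (t k)
      obtain ⟨l, rfl⟩ := hs i
      exact ⟨l, hi⟩)
    (fun l => by
      obtain ⟨i, hi⟩ := hI (s l)
      obtain ⟨k, rfl⟩ := ht i
      exact ⟨k, hi⟩)
  refine ⟨σ, ?_⟩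
  set D : I ⊕ Λ → I ⊕ Λ → Prop :=
    fun x y => bipartiteArcs P x y ∨ ∃ k, x = .inl (s k) ∧ y = .inr (t (σ k)) with hD
  have harc : ∀ k, D (.inl (s k)) (.inr (t (σ k))) := fun k => .inr ⟨k, rfl, rfl⟩
  have hP : ∀ l i, P l i → D (.inr l) (.inl i) := fun l i h => .inl ⟨l, i, rfl, rfl, h⟩
  have hss : ∀ k l, ReflTransGen D (.inl (s k)) (.inl (s l)) := by
    intro k l
    induction hσ k l with
    | single h => exact (ReflTransGen.single (harc _)).tail (hP _ _ h)
    | tail _ h ih => exact (ih.tail (harc _)).tail (hP _ _ h)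
  have hout : ∀ x, ∃ k, ReflTransGen D x (.inl (s k)) := by
    rintro (i | l)
    · obtain ⟨k, rfl⟩ := hs i
      exact ⟨k, .refl⟩
    · obtain ⟨i, hi⟩ := hΛ l
      obtain ⟨k, rfl⟩ := hs i
      exact ⟨k, .single (hP _ _ hi)⟩
  have hin : ∀ y, ∃ k, ReflTransGen D (.inl (s k)) y := by
    rintro (i | l)
    · obtain ⟨k, rfl⟩ := hs i
      exact ⟨k, .refl⟩
    · obtain ⟨k, rfl⟩ := ht l
      exact ⟨σ.symm k, .single (by simpa using harc (σ.symm k))⟩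
  intro x y
  obtain ⟨k, hk⟩ := hout x
  obtain ⟨l, hl⟩ := hin y
  exact (hk.trans (hss k l)).trans hl

/-! ### Construction of small generating sets -/

namespace IsReesFamily

variable {M A B G : Type*} [Semigroup M] [Group G] {mk : A → G → B → M}
  {p : B → A → G} {adj : B → A → Prop} {Z : Set M}

/-- Labels of walks from `a` to `b` give elements of a subsemigroup. -/
theorem mem_of_labelledWalk (H : IsReesFamily mk p adj Z) {I Λ : Type*} {α : I → A} {β : Λ → B}
    {S : Subsemigroup M} {E : I ⊕ Λ → I ⊕ Λ → G → Prop}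
    (hE : ∀ x y g, E x y g →
      (∃ l i, x = .inr l ∧ y = .inl i ∧ adj (β l) (α i) ∧ g = p (β l) (α i)) ∨
      ∃ i l, x = .inl i ∧ y = .inr l ∧ mk (α i) g (β l) ∈ S)
    {i l g} (h : LabelledWalk E (.inl i) (.inr l) g) : mk (α i) g (β l) ∈ S := by
  -- Walks starting in `Λ` must be included: such a walk is empty or begins with a sandwich entry,
  -- which the preceding generator absorbs.
  suffices key : ∀ x y g, LabelledWalk E x y g → y = .inr l →
      (∀ i, x = .inl i → mk (α i) g (β l) ∈ S) ∧
      (∀ l', x = .inr l' → (l' = l ∧ g = 1) ∨ ∃ i h, adj (β l') (α i) ∧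
        g = p (β l') (α i) * h ∧ mk (α i) h (β l) ∈ S) from (key _ _ _ h rfl).1 i rfl
  intro x y g h
  induction h with
  | nil x =>
    rintro rfl
    refine ⟨fun i h => (by cases h), fun l' h => .inl ⟨?_, rfl⟩⟩
    cases h; rfl
  | cons hxy _ ih =>
    intro hz
    obtain ⟨ih1, ih2⟩ := ih hz
    rcases hE _ _ _ hxy with ⟨l', i, rfl, rfl, hadj, rfl⟩ | ⟨i, l', rfl, rfl, hm⟩
    · refine ⟨fun i h => (by cases h), fun l'' h => .inr ⟨i, _, ?_, ?_, ih1 i rfl⟩⟩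
      · cases h; exact hadj
      · cases h; rfl
    · refine ⟨fun i' h => ?_, fun l'' h => (by cases h)⟩
      cases h
      rcases ih2 l' rfl with ⟨rfl, rfl⟩ | ⟨i', h', hadj, rfl, hm'⟩
      · simpa using hm
      · rw [← mul_assoc, ← H.mul hadj]
        exact S.mul_mem hm hm'

/-- Elements with non-isolated coordinates generate everything else together with one element
for each isolated coordinate. -/
theorem range_subset_of_pos (H : IsReesFamily mk p adj Z) {S : Subsemigroup M} {b₀ a₀}
    (h₀ : adj b₀ a₀)
    (hpos : ∀ a g b, (∃ b', adj b' a) → (∃ a', adj b a') → mk a g b ∈ S)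
    (hA : ∀ a, (∀ b, ¬ adj b a) → mk a 1 b₀ ∈ S)
    (hB : ∀ b, (∀ a, ¬ adj b a) → mk a₀ 1 b ∈ S) : reesRange mk ⊆ S := by
  have h1 : ∀ a g b, (∃ a', adj b a') → mk a g b ∈ S := by
    intro a g b hb
    by_cases ha : ∃ b', adj b' a
    · exact hpos a g b ha hb
    · have := S.mul_mem (hA a (not_exists.1 ha)) (hpos a₀ ((p b₀ a₀)⁻¹ * g) b ⟨_, h₀⟩ hb)
      rw [H.mul h₀] at this
      simpa using this
  rintro _ ⟨a, g, b, rfl⟩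
  by_cases hb : ∃ a', adj b a'
  · exact h1 a g b hb
  · have := S.mul_mem (h1 a (g * (p b₀ a₀)⁻¹) b₀ ⟨_, h₀⟩) (hB b (not_exists.1 hb))
    rw [H.mul h₀] at this
    simpa using this

/-- The `N` generators are arcs whose tails and heads cover all non-isolated vertices. The last
hypothesis forces fewer than `N` components, which frees two arcs for `u` and `v`. -/
theorem exists_generators [Finite A] [Finite B] [Finite G] (H : IsReesFamily mk p adj Z)
    {u v : G} (huv : Subgroup.closure {u, v} = ⊤) {b₀ a₀} (h₀ : adj b₀ a₀) {N : ℕ}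
    (hAN : Nat.card {a // ∃ b, adj b a} ≤ N) (hBN : Nat.card {b // ∃ a, adj b a} ≤ N)
    (h : Nat.card {a // ∃ b, adj b a} < N ∨ (∃ b a a', adj b a ∧ adj b a' ∧ a ≠ a') ∨
      ∃ a b b', adj b a ∧ adj b' a ∧ b ≠ b') :
    ∃ X : Finset M, X.card ≤ N + (Nat.card {a : A // ∀ b, ¬ adj b a} +
        Nat.card {b : B // ∀ a, ¬ adj b a}) ∧
      (X : Set M) ⊆ reesRange mk ∧ reesRange mk ⊆ Subsemigroup.closure (X : Set M) := by
  classical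
  let I := {a // ∃ b, adj b a}
  let Λ := {b // ∃ a, adj b a}
  let P : Λ → I → Prop := fun l i => adj l.1 i.1
  have hI : ∀ i, ∃ l, P l i := fun ⟨a, b, h⟩ => ⟨⟨b, a, h⟩, h⟩
  have hΛ : ∀ l, ∃ i, P l i := fun ⟨b, a, h⟩ => ⟨⟨a, b, h⟩, h⟩
  have : Nonempty I := ⟨⟨a₀, b₀, h₀⟩⟩
  have : Nonempty Λ := ⟨⟨b₀, a₀, h₀⟩⟩
  obtain ⟨s, hs⟩ := exists_surjective_fin (I := I) hAN
  obtain ⟨t, ht⟩ := exists_surjective_fin (I := Λ) hBN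
  obtain ⟨σ, hσ⟩ := exists_perm_strongly_connected hI hΛ hs ht
  have hlt : Nat.card (Quotient (Relation.EqvGen.setoid (bipartiteArcs P))) < N := by
    refine card_quotient_bipartite_lt hI hΛ hAN hBN ?_
    rcases h with h | ⟨b, a, a', h1, h2, hne⟩ | ⟨a, b, b', h1, h2, hne⟩
    · exact .inl h
    · exact .inr (.inl ⟨⟨b, a, h1⟩, ⟨a, b, h1⟩, ⟨a', b, h2⟩, h1, h2,
        fun h => hne (Subtype.ext_iff.1 h)⟩)
    · exact .inr (.inr ⟨⟨a, b, h1⟩, ⟨b, a, h1⟩, ⟨b', a, h2⟩, h1, h2,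
        fun h => hne (Subtype.ext_iff.1 h)⟩)
  obtain ⟨T, hTcard, hT⟩ := exists_finset_connecting
    (Relation.EqvGen.setoid (bipartiteArcs P)) (fun k => .inl (s k)) (fun k => .inr (t (σ k)))
    (fun x y => by
      induction hσ x y with
      | refl => exact .refl _
      | tail _ h ih =>
        refine ih.trans _ _ _ (.rel _ _ ?_)
        rcases h with h | h
        · exact .inl (.rel _ _ h)
        · exact .inr h)
  -- `T` has fewer arcs than there are components, hence at most `N - 2`.
  obtain ⟨i, hi, j, hj, hij⟩ : ∃ i ∈ Tᶜ, ∃ j ∈ Tᶜ, i ≠ j := by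
    refine Finset.one_lt_card.1 ?_
    rw [Finset.card_compl, Fintype.card_fin]
    omega
  have harcs : ∀ x y, bipartiteArcs P x y →
      ∃ g, ∃ l i, x = Sum.inr l ∧ y = Sum.inl i ∧ P l i ∧ g = p l.1 i.1 := by
    rintro x y ⟨l, i, rfl, rfl, h⟩
    exact ⟨_, l, i, rfl, rfl, h, rfl⟩
  obtain ⟨g, hg⟩ := exists_labels
    (fun x y g => ∃ l i, x = Sum.inr l ∧ y = Sum.inl i ∧ P l i ∧ g = p l.1 i.1)
    (fun k => .inl (s k)) (fun k => .inr (t (σ k))) T (Finset.mem_compl.1 hi)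
    (Finset.mem_compl.1 hj) hij huv
    (fun x y => by
      induction hT x y with
      | rel x y h =>
        rcases h with h | h
        · exact Relation.EqvGen.mono (fun _ _ h => Or.inl (harcs _ _ h)) _ _ h
        · exact .rel _ _ (.inr h)
      | refl => exact .refl _
      | symm _ _ _ ih => exact ih.symm
      | trans _ _ _ _ _ ih1 ih2 => exact ih1.trans _ _ _ ih2)
    (fun x y => Relation.ReflTransGen.mono (fun x y h => h.imp_left (harcs x y)) _ _ (hσ x y))
  have : Fintype {a : A // ∀ b, ¬ adj b a} := Fintype.ofFinite _
  have : Fintype {b : B // ∀ a, ¬ adj b a} := Fintype.ofFinite _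
  let F : Fin N ⊕ ({a : A // ∀ b, ¬ adj b a} ⊕ {b : B // ∀ a, ¬ adj b a}) → M :=
    Sum.elim (fun k => mk (s k).1 (g k) (t (σ k)).1)
      (Sum.elim (fun a => mk a.1 1 b₀) (fun b => mk a₀ 1 b.1))
  have hF : ∀ x, F x ∈ Subsemigroup.closure ((Finset.univ.image F : Finset M) : Set M) :=
    fun x => Subsemigroup.subset_closure (by simp)
  refine ⟨Finset.univ.image F, ?_, ?_, H.range_subset_of_pos h₀ ?_ ?_ ?_⟩
  · refine Finset.card_image_le.trans ?_
    simp [Nat.card_eq_fintype_card]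
  · intro m hm
    obtain ⟨x, -, rfl⟩ := Finset.mem_image.1 (Finset.mem_coe.1 hm)
    rcases x with k | a | b <;> exact ⟨_, _, _, rfl⟩
  · intro a h b ha hb
    refine H.mem_of_labelledWalk (α := fun i : I => i.1) (β := fun l : Λ => l.1) ?_
      (hg (.inl ⟨a, ha⟩) (.inr ⟨b, hb⟩) h)
    rintro x y h (⟨l, i, rfl, rfl, h1, h2⟩ | ⟨k, rfl, rfl, rfl⟩)
    · exact .inl ⟨l, i, rfl, rfl, h1, h2⟩
    · exact .inr ⟨_, _, rfl, rfl, hF (.inl k)⟩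
  · exact fun a ha => hF (.inr (.inl ⟨a, ha⟩))
  · exact fun b hb => hF (.inr (.inr ⟨b, hb⟩))

end IsReesFamily

/-! ### Rank of a subsemigroup through subsets of the ambient semigroup -/

section Rank

variable {M : Type*} [Semigroup M] (S : Subsemigroup M) [Finite S]

theorem semigroupRank_le_card {X : Finset M} (hX : Subsemigroup.closure (X : Set M) = S) :
    semigroupRank S ≤ X.card := by
  classical
  have hXS : ∀ x ∈ X, x ∈ S := fun x hx => hX ▸ Subsemigroup.subset_closure hx
  refine (semigroupRank_isLeast S).2 ⟨X.subtype (· ∈ S), ?_, ?_⟩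
  · rw [Finset.card_subtype, Finset.filter_true_of_mem hXS]
  · rw [← (Subsemigroup.map_injective_of_injective (f := MulMemClass.subtype S)
      Subtype.val_injective).eq_iff, MulHom.map_mclosure]
    have : (MulMemClass.subtype S) '' ((X.subtype (· ∈ S) : Finset S) : Set S) = X := by
      ext x
      simpa using hXS x
    rw [this, hX]
    ext x
    simp

theorem exists_finset_card_eq_semigroupRank :
    ∃ X : Finset M, X.card = semigroupRank S ∧ Subsemigroup.closure (X : Set M) = S := by
  classical
  obtain ⟨X, hX, hc⟩ := (semigroupRank_isLeast S).1
  refine ⟨X.map ⟨Subtype.val, Subtype.val_injective⟩, by simpa using hX, ?_⟩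
  have h := MulHom.map_mclosure (MulMemClass.subtype S) (X : Set S)
  rw [hc] at h
  have e : ((X.map ⟨Subtype.val, Subtype.val_injective⟩ : Finset M) : Set M) =
      (MulMemClass.subtype S) '' (X : Set S) := by
    simp
  rw [e, ← h]
  ext x
  simp

end Rank

/-! ### Transformations as a Rees family over the symmetric group -/

theorem exists_surjective_ker_eq {n r : ℕ} (b : Setoid (Fin n)) (hb : b.classes.ncard = r) :
    ∃ f : Fin n → Fin r, Function.Surjective f ∧ Setoid.ker f = b := by
  have hc : Nat.card (Quotient b) = r := by
    rw [Nat.card_congr (Setoid.quotientEquivClasses b)]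
    exact hb
  let e : Quotient b ≃ Fin r := Finite.equivFinOfCardEq hc
  refine ⟨fun x => e (Quotient.mk b x), e.surjective.comp Quotient.mk_surjective, ?_⟩
  ext x y
  rw [Setoid.ker_def, e.apply_eq_iff_eq]
  exact Quotient.eq

/-- A set is a transversal of a kernel if and only if the map is a bijection on it. -/
theorem isTransversal_iff_bijective {n r : ℕ} {a : Finset (Fin n)} {b : Setoid (Fin n)}
    {e : Fin r → Fin n} {f : Fin n → Fin r} (hea : Set.range e = a)
    (hf : Function.Surjective f) (hfb : Setoid.ker f = b) :
    IsTransversal a b ↔ Function.Bijective (f ∘ e) := by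
  subst hfb
  have hmem : ∀ y, e y ∈ a := fun y => by
    have : e y ∈ (a : Set (Fin n)) := hea ▸ ⟨y, rfl⟩
    exact this
  constructor
  · intro h
    have hsurj : Function.Surjective (f ∘ e) := by
      intro y
      obtain ⟨x, rfl⟩ := hf y
      obtain ⟨z, ⟨hza, hz⟩, -⟩ := h _ (Setoid.mem_classes (Setoid.ker f) x)
      obtain ⟨w, rfl⟩ : z ∈ Set.range e := hea ▸ hza
      exact ⟨w, hz⟩
    exact Finite.injective_iff_bijective.1 (Finite.injective_iff_surjective.2 hsurj)
  · rintro ⟨hinj, hsurj⟩ c ⟨x, rfl⟩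
    obtain ⟨y, hy⟩ := hsurj (f x)
    refine ⟨e y, ⟨hmem y, hy⟩, ?_⟩
    rintro z ⟨hza, hz⟩
    obtain ⟨w, rfl⟩ : z ∈ Set.range e := hea ▸ hza
    rw [hinj (a₁ := w) (a₂ := y)]
    exact Eq.trans hz hy.symm

section Transformations

variable {n r : ℕ} {A : Finset (Finset (Fin n))} {B : Finset (Setoid (Fin n))}

/-- The transformation with image parametrised by `e a`, kernel classes numbered by `f b`, and
the permutation `g` between the two. -/
def coordMap (e : A → Fin r → Fin n) (f : B → Fin n → Fin r) (a : A) (g : Equiv.Perm (Fin r))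
    (b : B) : Function.End (Fin n) :=
  fun x => e a (g (f b x))

open Classical in
/-- The permutation describing how the image `a` meets the kernel `b`. -/
noncomputable def coordSandwich (e : A → Fin r → Fin n) (f : B → Fin n → Fin r) (b : B) (a : A) :
    Equiv.Perm (Fin r) :=
  -- The value 1 is a dummy: off transversals the entry never enters a product.
  if h : Function.Bijective (f b ∘ e a) then Equiv.ofBijective _ h else 1

variable {e : A → Fin r → Fin n} {f : B → Fin n → Fin r}

theorem range_coordMap (hea : ∀ a, Set.range (e a) = (a.1 : Set (Fin n)))
    (hf : ∀ b, Function.Surjective (f b)) (a : A) (g : Equiv.Perm (Fin r)) (b : B) :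
    Set.range (coordMap e f a g b) = (a.1 : Set (Fin n)) := by
  have : Set.range (coordMap e f a g b) = Set.range (e a ∘ (g ∘ f b)) := rfl
  rw [this, (g.surjective.comp (hf b)).range_comp, hea]

theorem ker_coordMap (he : ∀ a, Function.Injective (e a)) (hfb : ∀ b, Setoid.ker (f b) = b.1)
    (a : A) (g : Equiv.Perm (Fin r)) (b : B) : Setoid.ker (coordMap e f a g b) = b.1 := by
  rw [← hfb b]
  ext x y
  simp only [Setoid.ker_def]
  exact ((he a).comp g.injective).eq_iff

/-- In the composite `e a ∘ g ∘ f b ∘ e a' ∘ g' ∘ f b'` the middle factor `f b ∘ e a'` is a self-map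
of `Fin r`. It is a permutation exactly for a transversal, and otherwise the rank drops. -/
theorem isReesFamily_coordMap (hA : ∀ a ∈ A, a.card = r) (he : ∀ a, Function.Injective (e a))
    (hea : ∀ a, Set.range (e a) = (a.1 : Set (Fin n))) (hf : ∀ b, Function.Surjective (f b))
    (hfb : ∀ b, Setoid.ker (f b) = b.1) :
    IsReesFamily (coordMap e f) (coordSandwich e f) (fun b a => IsTransversal a.1 b.1)
      {α : Function.End (Fin n) | (Set.range α).ncard < r} where
  inj := by
    intro a g b a' g' b' h
    obtain rfl : a = a' := by
      have := range_coordMap hea hf a g b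
      rw [h, range_coordMap hea hf] at this
      exact Subtype.ext (Finset.coe_injective this.symm)
    obtain rfl : b = b' := by
      have := ker_coordMap he hfb a g b
      rw [h, ker_coordMap he hfb] at this
      exact Subtype.ext this.symm
    refine ⟨rfl, Equiv.ext fun y => ?_, rfl⟩
    obtain ⟨x, rfl⟩ := hf b y
    exact he a (congrFun h x)
  mul := by
    intro a g b a' g' b' h
    rw [isTransversal_iff_bijective (hea a') (hf b) (hfb b)] at h
    funext x
    simp only [coordSandwich, dif_pos h]
    rfl
  zero := by
    intro a g b a' g' b' h
    rw [isTransversal_iff_bijective (hea a') (hf b) (hfb b)] at h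
    have hns : ¬ Function.Surjective (f b ∘ e a') := fun hs =>
      h ⟨Finite.injective_iff_surjective.2 hs, hs⟩
    have hsub : Set.range (coordMap e f a g b * coordMap e f a' g' b') ⊆
        (e a ∘ g) '' Set.range (f b ∘ e a') := by
      rintro _ ⟨x, rfl⟩
      exact ⟨_, ⟨g' (f b' x), rfl⟩, rfl⟩
    refine (Set.ncard_le_ncard hsub (Set.toFinite _)).trans_lt ?_
    refine (Set.ncard_image_le (Set.toFinite _)).trans_lt ?_
    have : Set.range (f b ∘ e a') ⊂ Set.univ := by
      rw [Set.ssubset_univ_iff]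
      exact fun h => hns (Set.range_eq_univ.1 h)
    simpa [Set.ncard_univ] using Set.ncard_lt_ncard this (Set.toFinite _)
  left := by
    intro z m hz
    exact (Set.ncard_le_ncard (Set.range_comp_subset_range m z) (Set.toFinite _)).trans_lt hz
  right := by
    intro z m hz
    have : Set.range (m * z) = m '' Set.range z := Set.range_comp m z
    change (Set.range (m * z)).ncard < r
    rw [this]
    exact (Set.ncard_image_le (Set.toFinite _)).trans_lt hz
  notMem := by
    intro a g b h
    change (Set.range (coordMap e f a g b)).ncard < r at h
    rw [range_coordMap hea hf, Set.ncard_coe_finset, hA a.1 a.2] at h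
    exact lt_irrefl _ h

theorem reesRange_coordMap (he : ∀ a, Function.Injective (e a))
    (hea : ∀ a, Set.range (e a) = (a.1 : Set (Fin n))) (hf : ∀ b, Function.Surjective (f b))
    (hfb : ∀ b, Setoid.ker (f b) = b.1) :
    reesRange (coordMap e f) = {α : Function.End (Fin n) |
      (∃ a ∈ A, Set.range α = (a : Set (Fin n))) ∧ Setoid.ker α ∈ B} := by
  ext α
  constructor
  · rintro ⟨a, g, b, rfl⟩
    refine ⟨⟨a.1, a.2, range_coordMap hea hf a g b⟩, ?_⟩
    rw [ker_coordMap he hfb]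
    exact b.2
  · rintro ⟨⟨a, ha, hαa⟩, hb⟩
    let a' : A := ⟨a, ha⟩
    let b' : B := ⟨_, hb⟩
    -- The permutation is read off by evaluating `α` on a representative of each kernel class.
    have h1 : ∀ y, ∃ z, e a' z = α (Function.surjInv (hf b') y) := fun y => by
      have : α (Function.surjInv (hf b') y) ∈ Set.range α := ⟨_, rfl⟩
      rw [hαa, ← hea a'] at this
      exact this
    choose g hg using h1
    have hker : ∀ x y, α x = α y ↔ f b' x = f b' y := fun x y => by
      rw [← Setoid.ker_def (f := f b'), hfb b']
      rfl
    have hginj : Function.Injective g := by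
      intro y y' h
      have : α (Function.surjInv (hf b') y) = α (Function.surjInv (hf b') y') := by
        rw [← hg, ← hg, h]
      rw [hker, Function.surjInv_eq (hf b'), Function.surjInv_eq (hf b')] at this
      exact this
    refine ⟨a', Equiv.ofBijective g (Finite.injective_iff_bijective.1 hginj), b', ?_⟩
    funext x
    refine Eq.trans ?_ (hg (f b' x)).symm
    rw [hker, Function.surjInv_eq (hf b')]

end Transformations

/-! ### Symmetric groups and counting -/

theorem exists_closure_pair_perm_fin {r : ℕ} (hr : 2 ≤ r) :
    ∃ u v : Equiv.Perm (Fin r), Subgroup.closure {u, v} = ⊤ := by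
  obtain ⟨k, rfl⟩ := Nat.exists_eq_add_of_le' hr
  -- A full cycle together with an adjacent transposition.
  exact ⟨finRotate (k + 2), _, Equiv.Perm.closure_cycle_adjacent_swap isCycle_finRotate
    support_finRotate 0⟩

/-- This is where r > 2 is essential; everything else works for r = 2. -/
theorem exists_perm_fin_not_comm {r : ℕ} (hr : 2 < r) :
    ∃ g h : Equiv.Perm (Fin r), g * h ≠ h * g := by
  obtain ⟨k, rfl⟩ := Nat.exists_eq_add_of_le' hr
  refine ⟨Equiv.swap 0 1, Equiv.swap 1 2, fun h => ?_⟩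
  have := congrArg Fin.val (Equiv.congr_fun h 0)
  simp [Equiv.Perm.mul_apply, Equiv.swap_apply_def, Fin.ext_iff] at this
  simp [Nat.mod_eq_of_lt (show 2 < k + 3 by omega)] at this

theorem Nat.card_eq_card_subtype_add_card_not {α : Type*} [Finite α] (q : α → Prop) :
    Nat.card α = Nat.card {x // q x} + Nat.card {x // ¬ q x} := by
  classical
  rw [← Nat.card_sum, Nat.card_congr (Equiv.sumCompl q)]

theorem card_eq_card_adj_add_card_isolated {A B : Type*} [Finite A] (adj : B → A → Prop) :
    Nat.card A = Nat.card {a // ∃ b, adj b a} + Nat.card {a // ∀ b, ¬ adj b a} := by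
  simpa only [not_exists] using Nat.card_eq_card_subtype_add_card_not fun a => ∃ b, adj b a

/-! ### The rank of a Rees family in the three cases -/

namespace IsReesFamily

variable {M A B G : Type*} [Semigroup M] [Group G] [Finite A] [Finite B] [Finite G]
  {mk : A → G → B → M} {p : B → A → G} {adj : B → A → Prop} {Z : Set M}
  {S : Subsemigroup M} [Finite S]

theorem rank_le (H : IsReesFamily mk p adj Z) (hS : S = Subsemigroup.closure (reesRange mk))
    (hG : ∃ u v : G, Subgroup.closure {u, v} = ⊤) {b₀ a₀} (h₀ : adj b₀ a₀) {N : ℕ}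
    (hAN : Nat.card {a // ∃ b, adj b a} ≤ N) (hBN : Nat.card {b // ∃ a, adj b a} ≤ N)
    (h : Nat.card {a // ∃ b, adj b a} < N ∨ (∃ b a a', adj b a ∧ adj b a' ∧ a ≠ a') ∨
      ∃ a b b', adj b a ∧ adj b' a ∧ b ≠ b') :
    semigroupRank S ≤ N + (Nat.card {a : A // ∀ b, ¬ adj b a} +
        Nat.card {b : B // ∀ a, ¬ adj b a}) := by
  obtain ⟨u, v, huv⟩ := hG
  obtain ⟨X, hcard, hX1, hX2⟩ := H.exists_generators huv h₀ hAN hBN h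
  refine (semigroupRank_le_card S ?_).trans hcard
  rw [hS]
  exact le_antisymm (Subsemigroup.closure_mono hX1) (Subsemigroup.closure_le.2 hX2)

theorem rank_eq_of_branching (H : IsReesFamily mk p adj Z)
    (hS : S = Subsemigroup.closure (reesRange mk))
    (hG : ∃ u v : G, Subgroup.closure {u, v} = ⊤)
    (h : (∃ b a a', adj b a ∧ adj b a' ∧ a ≠ a') ∨ ∃ a b b', adj b a ∧ adj b' a ∧ b ≠ b') :
    semigroupRank S = max (Nat.card {a // ∃ b, adj b a}) (Nat.card {b // ∃ a, adj b a}) +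
      (Nat.card {a : A // ∀ b, ¬ adj b a} + Nat.card {b : B // ∀ a, ¬ adj b a}) := by
  obtain ⟨b₀, a₀, h₀⟩ : ∃ b a, adj b a := by
    rcases h with ⟨b, a, -, h, -⟩ | ⟨a, b, -, h, -⟩ <;> exact ⟨b, a, h⟩
  refine le_antisymm (H.rank_le hS hG h₀ (le_max_left _ _) (le_max_right _ _) (.inr h)) ?_
  obtain ⟨X, hXc, hX⟩ := exists_finset_card_eq_semigroupRank S
  rw [hS] at hX
  have h1 := H.card_left_le hX h₀
  have h2 := H.card_right_le hX h₀
  rw [card_eq_card_adj_add_card_isolated adj] at h1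
  rw [card_eq_card_adj_add_card_isolated fun a b => adj b a] at h2
  omega

theorem rank_eq_of_matching (H : IsReesFamily mk p adj Z)
    (hS : S = Subsemigroup.closure (reesRange mk))
    (hG : ∃ u v : G, Subgroup.closure {u, v} = ⊤) (hG' : ∃ g h : G, g * h ≠ h * g)
    {b₀ a₀} (h₀ : adj b₀ a₀) (hl : ∀ b a a', adj b a → adj b a' → a = a')
    (hr : ∀ a b b', adj b a → adj b' a → b = b') :
    semigroupRank S = max (Nat.card {a // ∃ b, adj b a}) (Nat.card {b // ∃ a, adj b a}) +
      (Nat.card {a : A // ∀ b, ¬ adj b a} + Nat.card {b : B // ∀ a, ¬ adj b a}) + 1 := by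
  have hle : Nat.card {b // ∃ a, adj b a} ≤ Nat.card {a // ∃ b, adj b a} := by
    choose f hf using fun b : {b // ∃ a, adj b a} => b.2
    refine Nat.card_le_card_of_injective (fun b => ⟨f b, b.1, hf b⟩) fun b b' h => ?_
    have h := Subtype.ext_iff.1 h
    exact Subtype.ext (hr _ _ _ (hf b) ((show f b = f b' from h) ▸ hf b'))
  apply le_antisymm
  -- In a perfect matching the components are as many as the vertices on each side, so one extra arc
  -- is taken to leave two spare ones.
  · have := H.rank_le hS hG h₀ (N := Nat.card {a // ∃ b, adj b a} + 1) (by omega) (by omega)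
      (.inl (by omega))
    omega
  · obtain ⟨X, hXc, hX⟩ := exists_finset_card_eq_semigroupRank S
    rw [hS] at hX
    have h1 := H.card_left_lt hX h₀ hl hG'
    rw [card_eq_card_adj_add_card_isolated adj] at h1
    omega

theorem rank_eq_of_no_adj (H : IsReesFamily mk p adj Z)
    (hS : S = Subsemigroup.closure (reesRange mk)) (h : ∀ b a, ¬ adj b a) :
    semigroupRank S = Nat.card A * Nat.card B * Nat.card G := by
  classical
  have : Fintype (A × G × B) := Fintype.ofFinite _
  let F : A × G × B → M := fun x => mk x.1 x.2.1 x.2.2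
  have hF : Function.Injective F := by
    rintro ⟨a, g, b⟩ ⟨a', g', b'⟩ h
    obtain ⟨rfl, rfl, rfl⟩ := H.inj h
    rfl
  let Y : Finset M := Finset.univ.image F
  have hY : (Y : Set M) = reesRange mk := by
    ext m
    simp [Y, F, reesRange, eq_comm]
  have hYc : Y.card = Nat.card A * Nat.card B * Nat.card G := by
    rw [Finset.card_image_of_injective _ hF, Finset.card_univ, ← Nat.card_eq_fintype_card,
      Nat.card_prod, Nat.card_prod]
    ring
  rw [← hYc]
  apply le_antisymm
  · exact semigroupRank_le_card S (by rw [hY, hS])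
  · obtain ⟨X, hXc, hX⟩ := exists_finset_card_eq_semigroupRank S
    rw [hS] at hX
    rw [← hXc]
    have := H.range_subset h hX
    rw [← hY] at this
    exact Finset.card_le_card (Finset.coe_subset.1 this)

end IsReesFamily

/-! ### Degrees in Γ(A,B) expressed by transversality -/

section Graph

variable {n : ℕ} (A : Finset (Finset (Fin n))) (B : Finset (Setoid (Fin n)))

theorem vPos_imageVertices : vPos (transversalGraph A B) (imageVertices A B) =
    Nat.card {a : A // ∃ b : B, IsTransversal a.1 b.1} := by
  classical
  rw [vPos, imageVertices, Finset.filter_map, Finset.card_map, Nat.card_eq_fintype_card,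
    Fintype.card_subtype]
  congr 1
  ext a
  rw [Finset.mem_filter, Finset.mem_filter, Function.comp_apply,
    SimpleGraph.degree_pos_iff_exists_adj]
  simp [transversalGraph]

theorem vPos_kernelVertices : vPos (transversalGraph A B) (kernelVertices A B) =
    Nat.card {b : B // ∃ a : A, IsTransversal a.1 b.1} := by
  classical
  rw [vPos, kernelVertices, Finset.filter_map, Finset.card_map, Nat.card_eq_fintype_card,
    Fintype.card_subtype]
  congr 1
  ext a
  rw [Finset.mem_filter, Finset.mem_filter, Function.comp_apply,
    SimpleGraph.degree_pos_iff_exists_adj]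
  simp [transversalGraph]

theorem vZero_univ : vZero (transversalGraph A B) Finset.univ =
    Nat.card {a : A // ∀ b : B, ¬ IsTransversal a.1 b.1} +
      Nat.card {b : B // ∀ a : A, ¬ IsTransversal a.1 b.1} := by
  classical
  have h : ∀ x, (transversalGraph A B).degree x = 0 ↔ ∀ y, ¬ (transversalGraph A B).Adj x y := by
    intro x
    rw [← not_exists, ← SimpleGraph.degree_pos_iff_exists_adj, Nat.pos_iff_ne_zero, not_not]
  rw [vZero, ← Nat.card_sum, ← Fintype.card_subtype, ← Nat.card_eq_fintype_card]
  refine Nat.card_congr ((Equiv.subtypeSum).trans (Equiv.sumCongr ?_ ?_)) <;>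
  · refine Equiv.subtypeEquivRight fun x => ?_
    rw [h]
    simp [transversalGraph]

variable {A B}

theorem exists_branching_of_two_le_maxDeg (h : 2 ≤ maxDeg (transversalGraph A B)) :
    (∃ (b : B) (a a' : A), IsTransversal a.1 b.1 ∧ IsTransversal a'.1 b.1 ∧ a ≠ a') ∨
      ∃ (a : A) (b b' : B), IsTransversal a.1 b.1 ∧ IsTransversal a.1 b'.1 ∧ b ≠ b' := by
  classical
  have hne : Nonempty (A ⊕ B) := by
    by_contra hne
    rw [not_nonempty_iff] at hne
    rw [maxDeg, SimpleGraph.maxDegree_of_subsingleton] at h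
    omega
  obtain ⟨v, hv⟩ := (transversalGraph A B).exists_maximal_degree_vertex
  rw [maxDeg, hv, ← SimpleGraph.card_neighborFinset_eq_degree] at h
  obtain ⟨x, hx, y, hy, hxy⟩ := Finset.one_lt_card.1 (lt_of_lt_of_le one_lt_two h)
  rw [SimpleGraph.mem_neighborFinset] at hx hy
  rcases v with a | b <;> rcases x with x | x <;> rcases y with y | y <;>
    simp only [transversalGraph] at hx hy
  · exact .inr ⟨a, x, y, hx, hy, fun h => hxy (h ▸ rfl)⟩
  · exact .inl ⟨b, x, y, hx, hy, fun h => hxy (h ▸ rfl)⟩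

theorem matching_of_maxDeg_le_one (h : maxDeg (transversalGraph A B) ≤ 1) {x y z : A ⊕ B}
    (hy : (transversalGraph A B).Adj x y) (hz : (transversalGraph A B).Adj x z) : y = z := by
  classical
  have := ((transversalGraph A B).degree_le_maxDegree x).trans h
  rw [← SimpleGraph.card_neighborFinset_eq_degree, Finset.card_le_one] at this
  exact this y (by simpa using hy) z (by simpa using hz)

theorem exists_isTransversal_of_maxDeg_ne_zero (h : maxDeg (transversalGraph A B) ≠ 0) :
    ∃ (b : B) (a : A), IsTransversal a.1 b.1 := by
  classical
  by_contra! hno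
  apply h
  refine Nat.le_zero.1 ((transversalGraph A B).maxDegree_le_of_forall_degree_le 0 fun x => ?_)
  by_contra hx
  obtain ⟨y, hy⟩ := (SimpleGraph.degree_pos_iff_exists_adj _ x).1 (not_le.1 hx)
  rcases x with a | b <;> rcases y with a' | b' <;> simp only [transversalGraph] at hy
  · exact hno _ _ hy
  · exact hno _ _ hy

theorem not_isTransversal_of_maxDeg_eq_zero (h : maxDeg (transversalGraph A B) = 0)
    (b : B) (a : A) : ¬ IsTransversal a.1 b.1 := by
  classical
  intro hab
  have h1 := (transversalGraph A B).degree_le_maxDegree (.inl a)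
  have h2 : 0 < (transversalGraph A B).degree (.inl a) :=
    (SimpleGraph.degree_pos_iff_exists_adj _ _).2 ⟨.inr b, hab⟩
  exact absurd (h2.trans_le (h1.trans_eq h)) (lt_irrefl 0)

end Graph

/-! ### The rank formula -/

theorem theorem3p5 (n r : ℕ) (hr : 2 < r) (hrn : r < n)
    (A : Finset (Finset (Fin n))) (hA : ∀ a ∈ A, a.card = r)
    (B : Finset (Setoid (Fin n))) (hB : ∀ b ∈ B, b.classes.ncard = r) :
    (2 ≤ maxDeg (transversalGraph A B) →
      semigroupRank (prescribedSemigroup A B) =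
        max (vPos (transversalGraph A B) (imageVertices A B))
            (vPos (transversalGraph A B) (kernelVertices A B))
          + vZero (transversalGraph A B) Finset.univ) ∧
    (maxDeg (transversalGraph A B) = 1 →
      semigroupRank (prescribedSemigroup A B) =
        max (vPos (transversalGraph A B) (imageVertices A B))
            (vPos (transversalGraph A B) (kernelVertices A B))
          + vZero (transversalGraph A B) Finset.univ + 1) ∧
    (maxDeg (transversalGraph A B) = 0 →
      semigroupRank (prescribedSemigroup A B) = A.card * B.card * r.factorial) := by
  choose f hf hfb using fun b : B => exists_surjective_ker_eq b.1 (hB b.1 b.2)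
  let e : A → Fin r → Fin n := fun a => a.1.orderEmbOfFin (hA a.1 a.2)
  have he : ∀ a, Function.Injective (e a) := fun a => (a.1.orderEmbOfFin (hA a.1 a.2)).injective
  have hea : ∀ a, Set.range (e a) = (a.1 : Set (Fin n)) := fun a =>
    a.1.range_orderEmbOfFin (hA a.1 a.2)
  have H := isReesFamily_coordMap hA he hea hf hfb
  have hS : prescribedSemigroup A B = Subsemigroup.closure (reesRange (coordMap e f)) := by
    rw [reesRange_coordMap he hea hf hfb, prescribedSemigroup]
  have hG := exists_closure_pair_perm_fin hr.le
  rw [vPos_imageVertices, vPos_kernelVertices, vZero_univ]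
  refine ⟨fun h => ?_, fun h => ?_, fun h => ?_⟩
  · exact H.rank_eq_of_branching hS hG (exists_branching_of_two_le_maxDeg h)
  · obtain ⟨b₀, a₀, h₀⟩ := exists_isTransversal_of_maxDeg_ne_zero (A := A) (B := B) (by omega)
    exact H.rank_eq_of_matching hS hG (exists_perm_fin_not_comm hr) h₀
      (fun b a a' h1 h2 => Sum.inl_injective
        (matching_of_maxDeg_le_one h.le (x := .inr b) (y := .inl a) (z := .inl a') h1 h2))
      (fun a b b' h1 h2 => Sum.inr_injective
        (matching_of_maxDeg_le_one h.le (x := .inl a) (y := .inr b) (z := .inr b') h1 h2))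
  · rw [H.rank_eq_of_no_adj hS (not_isTransversal_of_maxDeg_eq_zero h)]
    simp [Nat.card_eq_fintype_card, Fintype.card_perm]
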